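/- Let $X$ be a complex Banach space and let $T$ be a closed linear operator in $X$, with domain $D(T)\subseteq X$ (not assumed dense), such that the resolvent set $\rho(T)$, i.e. the set of $\lambda\in\mathbb C$ for which $T-\lambda I\colon D(T)\to X$ has a bounded everywhere defined inverse, is nonempty; let $\sigma(T)=\mathbb C\setminus\rho(T)$. Definitions. Powers of operators are taken on their natural domains, $N$ and $R$ denote null space and range, and for an operator $A$ in $X$ let $\Delta(A)$ be the set of $n\in\mathbb N=\{0,1,2,\dots\}$ such that $R(A^m)\cap N(A)=R(A^n)\cap N(A)$ for all $m\ge n$. A closed operator $A$ is B-Fredholm if there is $d\in\Delta(A)$ such that $\dim\bigl(N(A)\cap R(A^d)\bigr)<\infty$ and $\operatorname{codim}\bigl(R(A)+N(A^d)\bigr)<\infty$; its index is then $\dim\bigl(N(A)\cap R(A^d)\bigr)-\operatorname{codim}\bigl(R(A)+N(A^d)\bigr)$, which does not depend on $d\in\Delta(A)$. It is B-Weyl if it is B-Fredholm of index $0$. Let $\sigma_{BW}(T)=\{\lambda\in\mathbb C: T-\lambda I\text{ is not B-Weyl}\}$ and $\sigma_{BD}(T)=\sigma(T)\setminus\sigma_{BW}(T)$;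 $T$ has a purely B-discrete spectrum if $\sigma(T)=\sigma_{BD}(T)$. A bounded linear operator $S$ on $X$ is meromorphic if $0$ is the only possible accumulation point of $\sigma(S)$ and every nonzero isolated point of $\sigma(S)$ is a pole of the resolvent $\mu\mapsto(S-\mu I)^{-1}$; $T$ has a meromorphic resolvent if $(T-\lambda I)^{-1}$ is a meromorphic operator for some $\lambda\in\rho(T)$. Theorem. $T$ has a purely B-discrete spectrum if and only if $T$ has a meromorphic resolvent. -/

import Mathlib

/-!
Closed linear operators on a complex Banach space are partially defined linear maps
`T : X →ₗ.[ℂ] X` with `T.IsClosed` (closed graph). The domain need not be dense.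
-/

namespace ClosedOperator

section Algebraic

variable {X : Type*} [AddCommGroup X] [Module ℂ X]

/-- The null space `N(T)`, as a subspace of `X`. -/
def nullSpace (T : X →ₗ.[ℂ] X) : Submodule ℂ X :=
  (LinearMap.ker T.toFun).map T.domain.subtype

/-- The range `R(T)`. -/
def rangeSpace (T : X →ₗ.[ℂ] X) : Submodule ℂ X :=
  LinearMap.range T.toFun

/-- The operator `T - z I`, with domain `D(T)`. -/
def shift (T : X →ₗ.[ℂ] X) (z : ℂ) : X →ₗ.[ℂ] X :=
  ⟨T.domain, T.toFun - z • T.domain.subtype⟩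

/-- The composition `S T` with its natural domain `{x ∈ D(T) | T x ∈ D(S)}`. -/
def comp (S T : X →ₗ.[ℂ] X) : X →ₗ.[ℂ] X :=
  S.comp (T.domRestrict ((S.domain.comap T.toFun).map T.domain.subtype)) (by
    rintro ⟨x, hx⟩
    obtain ⟨⟨y, hyS, hyx⟩, -⟩ := Submodule.mem_inf.1 hx
    have h : T.domRestrict _ ⟨x, hx⟩ = T y := LinearPMap.domRestrict_apply hyx.symm
    exact (congrArg (· ∈ S.domain) h).mpr hyS)

/-- The powers `T ^ n`, with their natural domains: `T ^ 0 = I` and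
`D(T ^ (n + 1)) = {x ∈ D(T ^ n) | T ^ n x ∈ D(T)}`. -/
def pow (T : X →ₗ.[ℂ] X) : ℕ → (X →ₗ.[ℂ] X)
  | 0 => (LinearMap.id : X →ₗ[ℂ] X).toPMap ⊤
  | n + 1 => comp T (pow T n)

/-- The set `Δ(T)` of degrees of stable iteration: those `n` with
`R(T ^ m) ∩ N(T) = R(T ^ n) ∩ N(T)` for all `m ≥ n`. -/
def stableDegrees (T : X →ₗ.[ℂ] X) : Set ℕ :=
  {n | ∀ m, n ≤ m →
    rangeSpace (pow T m) ⊓ nullSpace T = rangeSpace (pow T n) ⊓ nullSpace T}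

/-- `T` is B-Fredholm if for some `d ∈ Δ(T)` the space `N(T) ∩ R(T ^ d)` has finite dimension and
`R(T) + N(T ^ d)` has finite codimension. -/
def IsBFredholm (T : X →ₗ.[ℂ] X) : Prop :=
  ∃ d ∈ stableDegrees T,
    FiniteDimensional ℂ (nullSpace T ⊓ rangeSpace (pow T d) : Submodule ℂ X) ∧
    FiniteDimensional ℂ (X ⧸ (rangeSpace T ⊔ nullSpace (pow T d)))

/-- The number `dim (N(T) ∩ R(T ^ d)) - codim (R(T) + N(T ^ d))`. -/
noncomputable def indexAt (T : X →ₗ.[ℂ] X) (d : ℕ) : ℤ :=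
  (Module.finrank ℂ (nullSpace T ⊓ rangeSpace (pow T d) : Submodule ℂ X) : ℤ) -
    (Module.finrank ℂ (X ⧸ (rangeSpace T ⊔ nullSpace (pow T d))) : ℤ)

/-- The index of a B-Fredholm operator, computed at the least element of `Δ(T)`; by
`index_eq_indexAt` below, every element of `Δ(T)` gives the same number. -/
noncomputable def index (T : X →ₗ.[ℂ] X) : ℤ :=
  indexAt T (sInf (stableDegrees T))

/-- B-Weyl operators: B-Fredholm operators of index `0`. -/
def IsBWeyl (T : X →ₗ.[ℂ] X) : Prop :=
  IsBFredholm T ∧ index T = 0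

theorem mem_graph_comp (S T : X →ₗ.[ℂ] X) (x z : X) :
    (x, z) ∈ (comp S T).graph ↔ ∃ y, (x, y) ∈ T.graph ∧ (y, z) ∈ S.graph := by
  constructor
  · intro h
    obtain ⟨w, rfl, hw⟩ := (LinearPMap.mem_graph_iff _).1 h
    obtain ⟨⟨y, hyS, hyx⟩, -⟩ := Submodule.mem_inf.1 w.2
    refine ⟨T y, ?_, ?_⟩
    · rw [show ((w : X), T y) = ((y : X), T y) from by rw [← hyx]; rfl]
      exact T.mem_graph y
    · refine (LinearPMap.mem_graph_iff _).2 ⟨⟨T y, hyS⟩, rfl, ?_⟩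
      rw [← hw]
      change S _ = S _
      congr 1
      apply Subtype.ext
      exact (LinearPMap.domRestrict_apply (f := T) (y := y) hyx.symm).symm
  · rintro ⟨y, hxy, hyz⟩
    obtain ⟨a, rfl, rfl⟩ := (LinearPMap.mem_graph_iff _).1 hxy
    obtain ⟨b, hb, rfl⟩ := (LinearPMap.mem_graph_iff _).1 hyz
    have hb' : T a ∈ S.domain := by
      have := b.2
      rw [hb] at this
      exact this
    have hmem : (a : X) ∈ (comp S T).domain :=
      Submodule.mem_inf.2 ⟨⟨a, hb', rfl⟩, a.2⟩
    refine (LinearPMap.mem_graph_iff _).2 ⟨⟨a, hmem⟩, rfl, ?_⟩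
    change S _ = S _
    congr 1
    apply Subtype.ext
    exact (LinearPMap.domRestrict_apply (f := T) (y := a) rfl).trans hb.symm

theorem mem_nullSpace (T : X →ₗ.[ℂ] X) (x : X) : x ∈ nullSpace T ↔ (x, 0) ∈ T.graph := by
  rw [LinearPMap.mem_graph_iff]
  constructor
  · rintro ⟨y, hy, rfl⟩
    exact ⟨y, rfl, hy⟩
  · rintro ⟨y, hy, h⟩
    exact ⟨y, h, hy⟩

theorem mem_rangeSpace (T : X →ₗ.[ℂ] X) (y : X) : y ∈ rangeSpace T ↔ ∃ x, (x, y) ∈ T.graph := by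
  constructor
  · rintro ⟨x, rfl⟩
    exact ⟨x, T.mem_graph x⟩
  · rintro ⟨x, h⟩
    obtain ⟨a, -, ha⟩ := (LinearPMap.mem_graph_iff _).1 h
    exact ⟨a, ha⟩

theorem mem_graph_pow_succ (T : X →ₗ.[ℂ] X) (n : ℕ) (x z : X) :
    (x, z) ∈ (pow T (n + 1)).graph ↔ ∃ y, (x, y) ∈ (pow T n).graph ∧ (y, z) ∈ T.graph :=
  mem_graph_comp _ _ _ _

theorem mem_graph_pow_zero (T : X →ₗ.[ℂ] X) (x z : X) :
    (x, z) ∈ (pow T 0).graph ↔ x = z := by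
  simp [pow, LinearPMap.mem_graph_iff]

theorem mem_graph_pow_succ' (T : X →ₗ.[ℂ] X) (n : ℕ) : ∀ x z : X,
    (x, z) ∈ (pow T (n + 1)).graph ↔ ∃ y, (x, y) ∈ T.graph ∧ (y, z) ∈ (pow T n).graph := by
  induction n with
  | zero =>
    intro x z
    simp [mem_graph_pow_succ, mem_graph_pow_zero, -LinearPMap.mem_graph_iff]
  | succ n ih =>
    intro x z
    rw [mem_graph_pow_succ]
    constructor
    · rintro ⟨y, hy, hz⟩
      obtain ⟨w, hw, hwy⟩ := (ih x y).1 hy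
      exact ⟨w, hw, (mem_graph_pow_succ T n w z).2 ⟨y, hwy, hz⟩⟩
    · rintro ⟨w, hw, hwz⟩
      obtain ⟨y, hy, hz⟩ := (mem_graph_pow_succ T n w z).1 hwz
      exact ⟨y, (ih x y).2 ⟨w, hw, hy⟩, hz⟩

/-- Past a degree of stable iteration, the spaces `R(T) + N(T ^ n)` are stationary too. -/
theorem sup_nullSpace_eq (T : X →ₗ.[ℂ] X) {d : ℕ} (hd : d ∈ stableDegrees T) {m : ℕ}
    (hm : d ≤ m) :
    rangeSpace T ⊔ nullSpace (pow T m) = rangeSpace T ⊔ nullSpace (pow T d) := by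
  induction m, hm using Nat.le_induction with
  | base => rfl
  | succ m hm ih =>
    rw [← ih]
    apply le_antisymm
    · refine sup_le le_sup_left fun x hx => ?_
      obtain ⟨y, hxy, hy⟩ := (mem_graph_pow_succ T m x 0).1 ((mem_nullSpace _ _).1 hx)
      have hy' : y ∈ rangeSpace (pow T m) ⊓ nullSpace T :=
        ⟨(mem_rangeSpace _ _).2 ⟨x, hxy⟩, (mem_nullSpace _ _).2 hy⟩
      rw [hd m hm, ← hd (m + 1) (by omega)] at hy'
      obtain ⟨u, hu⟩ := (mem_rangeSpace _ _).1 hy'.1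
      obtain ⟨w, huw, hwy⟩ := (mem_graph_pow_succ' T m u y).1 hu
      have hsub : (x - w, (0 : X)) ∈ (pow T m).graph := by
        have := (pow T m).graph.sub_mem hxy hwy
        simpa using this
      rw [← sub_add_cancel x w]
      exact add_mem (Submodule.mem_sup_right ((mem_nullSpace _ _).2 hsub))
        (Submodule.mem_sup_left ((mem_rangeSpace _ _).2 ⟨u, huw⟩))
    · refine sup_le le_sup_left (le_sup_of_le_right fun x hx => ?_)
      exact (mem_nullSpace _ _).2 ((mem_graph_pow_succ T m x 0).2
        ⟨0, (mem_nullSpace _ _).1 hx, zero_mem _⟩)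

/-- The index does not depend on the degree of stable iteration at which it is computed. -/
theorem index_eq_indexAt (T : X →ₗ.[ℂ] X) {d : ℕ} (hd : d ∈ stableDegrees T) :
    index T = indexAt T d := by
  have h0 : sInf (stableDegrees T) ∈ stableDegrees T := Nat.sInf_mem ⟨d, hd⟩
  have hle : sInf (stableDegrees T) ≤ d := Nat.sInf_le hd
  unfold index indexAt
  rw [sup_nullSpace_eq T h0 hle, inf_comm (nullSpace T), inf_comm (nullSpace T), h0 d hle]

end Algebraic

section Spectral

variable {X : Type*} [NormedAddCommGroup X] [NormedSpace ℂ X]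

/-- `S` is the bounded inverse `(T - z I)⁻¹`: it maps `X` into `D(T)` and is a two-sided inverse of
`T - z I : D(T) → X`. -/
def IsResolventAt (T : X →ₗ.[ℂ] X) (z : ℂ) (S : X →L[ℂ] X) : Prop :=
  (∀ y : X, ∃ x : (shift T z).domain, (x : X) = S y ∧ shift T z x = y) ∧
    ∀ x : (shift T z).domain, S (shift T z x) = x

/-- The resolvent set `ρ(T)`. -/
def resolventSet (T : X →ₗ.[ℂ] X) : Set ℂ :=
  {z | ∃ S : X →L[ℂ] X, IsResolventAt T z S}

/-- The spectrum `σ(T)`. -/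
def spectrum (T : X →ₗ.[ℂ] X) : Set ℂ :=
  (resolventSet T)ᶜ

/-- The B-Weyl spectrum `σ_BW(T)`. -/
def bWeylSpectrum (T : X →ₗ.[ℂ] X) : Set ℂ :=
  {z | ¬ IsBWeyl (shift T z)}

/-- The B-discrete spectrum `σ_BD(T)`. -/
def bDiscreteSpectrum (T : X →ₗ.[ℂ] X) : Set ℂ :=
  spectrum T \ bWeylSpectrum T

/-- `T` has a purely B-discrete spectrum. -/
def HasPurelyBDiscreteSpectrum (T : X →ₗ.[ℂ] X) : Prop :=
  spectrum T = bDiscreteSpectrum T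

/-- `z` is a pole of the function `f`. -/
def IsPole {E : Type*} [NormedAddCommGroup E] [NormedSpace ℂ E] (f : ℂ → E) (z : ℂ) : Prop :=
  MeromorphicAt f z ∧ meromorphicOrderAt f z < 0

/-- A bounded operator `S` is meromorphic if `0` is the only possible accumulation point of `σ(S)`
and every nonzero isolated point of `σ(S)` is a pole of the resolvent of `S`. -/
def IsMeromorphicOperator (S : X →L[ℂ] X) : Prop :=
  (∀ z : ℂ, AccPt z (Filter.principal (_root_.spectrum ℂ S)) → z = 0) ∧
    ∀ z ∈ _root_.spectrum ℂ S, z ≠ 0 →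
      ¬ AccPt z (Filter.principal (_root_.spectrum ℂ S)) → IsPole (resolvent S) z

/-- `T` has a meromorphic resolvent: for some `z ∈ ρ(T)` the bounded operator `(T - z I)⁻¹` is
meromorphic. -/
def HasMeromorphicResolvent (T : X →ₗ.[ℂ] X) : Prop :=
  ∃ (z : ℂ) (S : X →L[ℂ] X), IsResolventAt T z S ∧ IsMeromorphicOperator S

end Spectral

end ClosedOperator

/-! Fix `z` in the resolvent set and let `S` be the inverse of `T - z`. Then `T - l` is `S⁻¹(1 - (l
- z)S)`, and since `S` is injective and commutes with `1 - (l - z)S`, both operators have the same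
ranges and null spaces of powers. Hence `T` is purely B-discrete iff `S - m` is B-Weyl for every `m
≠ 0` (`IsResolventAt.forall_isBWeyl_iff`), and the theorem becomes a statement about the bounded
operator `S`.

If `S` is meromorphic, put `a = S - m`. Clearing the pole gives `a ^ p = a ^ (p + 1) * b` with `b`
commuting with `a`, so both defect spaces at degree `p` vanish.

Conversely, let `a = S - m` be B-Weyl, with `d` a degree as in the definition. If `N(a) ∩ R(a ^ d) =
0`, index zero forces `R(a) + N(a ^ d) = X`; then `a` has a Drazin inverse (`exists_drazin`), and
the resolvent is meromorphic at `m`. Otherwise a power series of eigenvectors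
(`eventually_exists_eigenvector`) puts a whole neighbourhood of `m` in the spectrum. Both
alternatives are open and they exclude each other; as `ℂ \ {0}` is connected and the first holds far
out, it holds everywhere. -/

namespace ClosedOperator

/-! ### Transfer of B-Weyl between an unbounded operator and an endomorphism. -/

section Transfer

variable {X : Type*} [AddCommGroup X] [Module ℂ X]

/-- An everywhere defined operator is B-Weyl. -/
def IsBWeylEnd (f : Module.End ℂ X) : Prop :=
  ∃ d : ℕ, (∀ m, d ≤ m → LinearMap.range (f ^ m) ⊓ LinearMap.ker f =
      LinearMap.range (f ^ d) ⊓ LinearMap.ker f) ∧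
    FiniteDimensional ℂ (LinearMap.ker f ⊓ LinearMap.range (f ^ d) : Submodule ℂ X) ∧
    FiniteDimensional ℂ (X ⧸ (LinearMap.range f ⊔ LinearMap.ker (f ^ d))) ∧
    Module.finrank ℂ (LinearMap.ker f ⊓ LinearMap.range (f ^ d) : Submodule ℂ X) =
      Module.finrank ℂ (X ⧸ (LinearMap.range f ⊔ LinearMap.ker (f ^ d)))

theorem pow_one_graph (T : X →ₗ.[ℂ] X) : (pow T 1).graph = T.graph := by
  ext ⟨x, y⟩
  rw [mem_graph_pow_succ]
  simp [mem_graph_pow_zero, -LinearPMap.mem_graph_iff]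

theorem isBWeyl_iff_of_pow_eq {T : X →ₗ.[ℂ] X} {f : Module.End ℂ X}
    (hr : ∀ n, rangeSpace (pow T n) = LinearMap.range (f ^ n))
    (hk : ∀ n, nullSpace (pow T n) = LinearMap.ker (f ^ n)) :
    IsBWeyl T ↔ IsBWeylEnd f := by
  have hr1 : rangeSpace T = LinearMap.range f := by
    rw [← pow_one f, ← hr 1]
    ext y
    rw [mem_rangeSpace, mem_rangeSpace, pow_one_graph]
  have hk1 : nullSpace T = LinearMap.ker f := by
    rw [← pow_one f, ← hk 1]
    ext y
    rw [mem_nullSpace, mem_nullSpace, pow_one_graph]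
  constructor
  · rintro ⟨⟨d, hd, h1, h2⟩, hi⟩
    rw [index_eq_indexAt T hd, indexAt, sub_eq_zero, Nat.cast_inj] at hi
    simp only [stableDegrees, Set.mem_ofPred_eq, hr, hk1] at hd
    rw [hr1, hk1, hr, hk] at hi
    rw [hk1, hr] at h1
    rw [hr1, hk] at h2
    exact ⟨d, hd, h1, h2, hi⟩
  · rintro ⟨d, hd, h1, h2, hi⟩
    have hd' : d ∈ stableDegrees T := by
      simpa only [stableDegrees, Set.mem_ofPred_eq, hr, hk1] using hd
    rw [← hk1, ← hr] at h1
    rw [← hr1, ← hk] at h2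
    rw [← hr1, ← hk1, ← hr, ← hk] at hi
    refine ⟨⟨d, hd', h1, h2⟩, ?_⟩
    rw [index_eq_indexAt T hd', indexAt, hi, sub_self]

theorem isBWeylEnd_smul {f : Module.End ℂ X} {c : ℂ} (hc : c ≠ 0) (hf : IsBWeylEnd f) :
    IsBWeylEnd (c • f) := by
  obtain ⟨d, hd⟩ := hf
  have hk : LinearMap.ker (c • f) = LinearMap.ker f := LinearMap.ker_smul _ _ hc
  have hr : LinearMap.range (c • f) = LinearMap.range f := LinearMap.range_smul _ _ hc
  have hkn : ∀ n, LinearMap.ker ((c • f) ^ n) = LinearMap.ker (f ^ n) := fun n => by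
    rw [smul_pow, LinearMap.ker_smul _ _ (pow_ne_zero _ hc)]
  have hrn : ∀ n, LinearMap.range ((c • f) ^ n) = LinearMap.range (f ^ n) := fun n => by
    rw [smul_pow, LinearMap.range_smul _ _ (pow_ne_zero _ hc)]
  refine ⟨d, ?_⟩
  rw [hk, hr, hkn, hrn]
  simpa only [hrn] using hd

/-- An endomorphism with `f ^ p = f ^ (p + 1) b` for some commuting `b` is B-Weyl. -/
theorem isBWeylEnd_of_pow_eq {f b : Module.End ℂ X} (hfb : Commute f b) {p : ℕ}
    (h : f ^ p = f ^ (p + 1) * b) : IsBWeylEnd f := by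
  have hbot : LinearMap.ker f ⊓ LinearMap.range (f ^ p) = ⊥ := by
    rw [eq_bot_iff]
    rintro _ ⟨hx, x, rfl⟩
    have h' : f ^ p = b * (f * f ^ p) := by
      rw [← pow_succ', ← (hfb.pow_left (p + 1)).eq, ← h]
    have : (f ^ p) x = b (f ((f ^ p) x)) := by conv_lhs => rw [h']; simp
    rw [Submodule.mem_bot, this, LinearMap.mem_ker.1 hx, map_zero]
  have htop : LinearMap.range f ⊔ LinearMap.ker (f ^ p) = ⊤ := by
    rw [eq_top_iff]
    intro x _
    rw [← sub_add_cancel x (f (b x)), add_comm]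
    refine add_mem (Submodule.mem_sup_left ⟨b x, rfl⟩) (Submodule.mem_sup_right ?_)
    rw [LinearMap.mem_ker, map_sub, sub_eq_zero]
    conv_lhs => rw [h, pow_succ]
    rfl
  refine ⟨p, fun m hm => ?_, ?_, ?_, ?_⟩
  · have hle : LinearMap.range (f ^ m) ≤ LinearMap.range (f ^ p) := by
      obtain ⟨k, rfl⟩ := Nat.exists_eq_add_of_le hm
      rw [pow_add]
      exact LinearMap.range_comp_le_range _ _
    rw [inf_comm _ (LinearMap.ker f), inf_comm _ (LinearMap.ker f), hbot, eq_bot_iff, ← hbot]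
    exact inf_le_inf_left _ hle
  · rw [hbot]; infer_instance
  · rw [htop]; infer_instance
  · rw [hbot, htop, finrank_bot]
    exact (Module.finrank_zero_of_subsingleton).symm

/-- The polynomial `1 - (1 - c s) ^ k` is divisible by `s`. -/
theorem sub_pow_apply_mem_range (s : Module.End ℂ X) (c : ℂ) (k : ℕ) (x : X) :
    x - ((1 - c • s) ^ k) x ∈ LinearMap.range s := by
  induction k generalizing x with
  | zero => simp
  | succ k ih =>
    have h := add_mem (ih ((1 - c • s) x)) (LinearMap.mem_range_self s (c • x))
    convert h using 1
    rw [pow_succ, Module.End.mul_apply, LinearMap.sub_apply, LinearMap.smul_apply, map_smul]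
    simp only [Module.End.one_apply]
    abel

/-- Modulo `R(s)` the operator `(1 - c s) ^ k` is the identity, so the hypothesis gives `x = s v`.
Injectivity cancels one factor `s`, and the argument repeats with `v`. -/
theorem mem_range_pow_of_pow_apply_mem {s : Module.End ℂ X} (hs : Function.Injective s) (c : ℂ)
    (k : ℕ) {n : ℕ} {x : X} (h : ((1 - c • s) ^ k) x ∈ LinearMap.range (s ^ n)) :
    x ∈ LinearMap.range (s ^ n) := by
  induction n generalizing x with
  | zero => simp
  | succ n ih =>
    obtain ⟨u, hu⟩ := h
    rw [pow_succ'] at hu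
    have hx := add_mem (sub_pow_apply_mem_range s c k x)
      (hu ▸ LinearMap.mem_range_self s ((s ^ n) u) : ((1 - c • s) ^ k) x ∈ LinearMap.range s)
    rw [sub_add_cancel] at hx
    obtain ⟨v, rfl⟩ := hx
    have hcomm : Commute ((1 - c • s) ^ k) s :=
      ((Commute.one_left s).sub_left ((Commute.refl s).smul_left c)).pow_left k
    have h1 : ((1 - c • s) ^ k) (s v) = s (((1 - c • s) ^ k) v) :=
      LinearMap.congr_fun hcomm.eq v
    obtain ⟨w, rfl⟩ := ih ⟨u, hs (hu.trans h1)⟩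
    exact ⟨w, by rw [pow_succ']; rfl⟩

theorem commute_one_sub_smul_pow (s : Module.End ℂ X) (c : ℂ) (k n : ℕ) :
    Commute ((1 - c • s) ^ k) (s ^ n) :=
  ((Commute.one_left s).sub_left ((Commute.refl s).smul_left c)).pow_pow k n

/-- This is `T ^ n = s⁻ⁿ (1 - c s) ^ n`, natural domains included. The domain is the issue: the
right-hand equation must supply the intermediate value `T x`, which it does by forcing `x = s v`,
whence `T x = (1 - c s) v`. -/
theorem mem_graph_pow_iff {T : X →ₗ.[ℂ] X} {s : Module.End ℂ X} (hs : Function.Injective s)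
    {c : ℂ} (hT : ∀ x y, (x, y) ∈ T.graph ↔ (1 - c • s) x = s y) (n : ℕ) (x y : X) :
    (x, y) ∈ (pow T n).graph ↔ ((1 - c • s) ^ n) x = (s ^ n) y := by
  induction n generalizing x y with
  | zero => rw [mem_graph_pow_zero]; rfl
  | succ n ih =>
    rw [mem_graph_pow_succ']
    have hc := fun k n (x : X) => LinearMap.congr_fun (commute_one_sub_smul_pow s c k n).eq x
    constructor
    · rintro ⟨w, hw, hwy⟩
      rw [hT] at hw
      rw [ih] at hwy
      rw [pow_succ, pow_succ', Module.End.mul_apply, hw, Module.End.mul_apply, ← hwy]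
      simpa using hc n 1 w
    · intro h
      have hx : x ∈ LinearMap.range (s ^ 1) :=
        mem_range_pow_of_pow_apply_mem hs c (n + 1) ⟨(s ^ n) y, by rw [h, pow_one, pow_succ']; rfl⟩
      rw [pow_one] at hx
      obtain ⟨v, rfl⟩ := hx
      refine ⟨(1 - c • s) v, (hT _ _).2 (by simp), (ih _ _).2 (hs ?_)⟩
      rw [pow_succ' s] at h
      refine Eq.trans ?_ h
      rw [← Module.End.mul_apply (_ ^ n), ← pow_succ]
      simpa using (hc (n + 1) 1 v).symm

theorem isBWeyl_iff_isBWeylEnd {T : X →ₗ.[ℂ] X} {s : Module.End ℂ X} (hs : Function.Injective s)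
    {c : ℂ} (hT : ∀ x y, (x, y) ∈ T.graph ↔ (1 - c • s) x = s y) :
    IsBWeyl T ↔ IsBWeylEnd (1 - c • s) := by
  refine isBWeyl_iff_of_pow_eq (fun n => ?_) fun n => ?_
  · ext y
    rw [mem_rangeSpace]
    have hc := fun (x : X) => LinearMap.congr_fun (commute_one_sub_smul_pow s c n n).eq x
    have hsn : Function.Injective (s ^ n) := by
      rw [Module.End.coe_pow]; exact hs.iterate n
    constructor
    -- The equation `(1 - c s) ^ n x = s ^ n y` forces `x = s ^ n v`; cancelling `s ^ n` leaves `y =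
    -- (1 - c s) ^ n v`.
    · rintro ⟨x, hx⟩
      rw [mem_graph_pow_iff hs hT] at hx
      obtain ⟨v, rfl⟩ := mem_range_pow_of_pow_apply_mem hs c n ⟨y, hx.symm⟩
      exact ⟨v, hsn ((hc v).symm.trans hx)⟩
    · rintro ⟨v, rfl⟩
      exact ⟨(s ^ n) v, (mem_graph_pow_iff hs hT n _ _).2 (hc v)⟩
  · ext x
    rw [mem_nullSpace, mem_graph_pow_iff hs hT, map_zero, LinearMap.mem_ker]

end Transfer

/-! ### Reduction to the resolvent operator. -/

section Resolvent

variable {X : Type*} [NormedAddCommGroup X] [NormedSpace ℂ X]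

theorem IsResolventAt.injective {T : X →ₗ.[ℂ] X} {z : ℂ} {S : X →L[ℂ] X}
    (h : IsResolventAt T z S) : Function.Injective S := by
  refine (injective_iff_map_eq_zero S).2 fun y hy => ?_
  obtain ⟨a, ha, rfl⟩ := h.1 y
  rw [hy] at ha
  rw [show a = 0 from Subtype.ext ha]
  exact map_zero (shift T z).toFun

theorem IsResolventAt.mem_graph_shift_iff {T : X →ₗ.[ℂ] X} {z : ℂ} {S : X →L[ℂ] X}
    (h : IsResolventAt T z S) (l : ℂ) (x y : X) :
    (x, y) ∈ (shift T l).graph ↔ (1 - (l - z) • (S : Module.End ℂ X)) x = S y := by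
  have e : (1 - (l - z) • (S : Module.End ℂ X)) x = x - (l - z) • S x := by simp
  rw [e, LinearPMap.mem_graph_iff]
  constructor
  · rintro ⟨a, rfl, rfl⟩
    have h2 := h.2 a
    have ha : shift T z a = shift T l a + (l - z) • (a : X) := by
      change T a - z • (a : X) = T a - l • (a : X) + (l - z) • (a : X)
      module
    rw [ha, map_add, map_smul] at h2
    exact sub_eq_iff_eq_add.2 h2.symm
  · intro hx
    obtain ⟨a, ha, hv⟩ := h.1 (y + (l - z) • x)
    have hax : (a : X) = x := by
      rw [ha, map_add, map_smul, ← hx, sub_add_cancel]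
    refine ⟨a, hax, ?_⟩
    change T a - l • (a : X) = y
    have hv' : T a - z • (a : X) = y + (l - z) • x := hv
    rw [hax] at hv' ⊢
    rw [sub_eq_iff_eq_add] at hv'
    rw [hv']
    module

theorem IsResolventAt.isBWeyl_shift_iff {T : X →ₗ.[ℂ] X} {z : ℂ} {S : X →L[ℂ] X}
    (h : IsResolventAt T z S) (l : ℂ) :
    IsBWeyl (shift T l) ↔ IsBWeylEnd (1 - (l - z) • (S : Module.End ℂ X)) :=
  isBWeyl_iff_isBWeylEnd h.injective (h.mem_graph_shift_iff l)

theorem isBWeylEnd_one {X : Type*} [AddCommGroup X] [Module ℂ X] :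
    IsBWeylEnd (1 : Module.End ℂ X) :=
  isBWeylEnd_of_pow_eq (Commute.one_left 1) (p := 0) (by simp)

theorem IsResolventAt.forall_isBWeyl_iff {T : X →ₗ.[ℂ] X} {z : ℂ} {S : X →L[ℂ] X}
    (h : IsResolventAt T z S) : (∀ l, IsBWeyl (shift T l)) ↔
      ∀ m : ℂ, m ≠ 0 → IsBWeylEnd ((S : Module.End ℂ X) - m • 1) := by
  simp only [h.isBWeyl_shift_iff]
  constructor
  · intro H m hm
    -- With `l = m⁻¹ + z`, `-m (1 - (l - z) S) = S - m`.
    have := isBWeylEnd_smul (neg_ne_zero.2 hm) (H (m⁻¹ + z))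
    convert this using 1
    rw [add_sub_cancel_right, smul_sub, smul_smul, neg_mul, mul_inv_cancel₀ hm]
    module
  · intro H l
    by_cases hl : l - z = 0
    · rw [hl, zero_smul, sub_zero]
      exact isBWeylEnd_one
    · have := isBWeylEnd_smul (neg_ne_zero.2 hl) (H (l - z)⁻¹ (inv_ne_zero hl))
      convert this using 1
      rw [smul_sub, smul_smul, neg_mul, mul_inv_cancel₀ hl]
      module

theorem isBWeyl_of_mem_resolventSet {T : X →ₗ.[ℂ] X} {z : ℂ} (h : z ∈ resolventSet T) :
    IsBWeyl (shift T z) := by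
  obtain ⟨S, hS⟩ := h
  rw [hS.isBWeyl_shift_iff, sub_self, zero_smul, sub_zero]
  exact isBWeylEnd_one

/-- Points of the resolvent set satisfy the B-Weyl condition automatically, so the restriction to
the spectrum can be dropped. -/
theorem hasPurelyBDiscreteSpectrum_iff (T : X →ₗ.[ℂ] X) :
    HasPurelyBDiscreteSpectrum T ↔ ∀ l, IsBWeyl (shift T l) := by
  constructor
  · intro H l
    by_cases hl : l ∈ resolventSet T
    · exact isBWeyl_of_mem_resolventSet hl
    · have : l ∈ bDiscreteSpectrum T := H ▸ (show l ∈ spectrum T from hl)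
      exact not_not.1 this.2
  · intro H
    exact Set.Subset.antisymm (fun l hl => ⟨hl, not_not.2 (H l)⟩) fun l hl => hl.1

end Resolvent

end ClosedOperator
-- Poles of the resolvent and Drazin inverses in a normed algebra.
namespace ClosedOperator

open Filter Topology

theorem commute_ringInverse {M : Type*} [MonoidWithZero M] {a b : M} (h : Commute a b) :
    Commute a (Ring.inverse b) := by
  by_cases hb : IsUnit b
  · obtain ⟨u, rfl⟩ := hb
    rw [Ring.inverse_unit]
    exact h.units_inv_right
  · rw [Ring.inverse_non_unit _ hb]
    exact Commute.zero_right a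

section Algebra

variable {A : Type*} [NormedRing A] [NormedAlgebra ℂ A]

/-- If `(w - a) G(w) = w ^ p - c` near `w = 0` with `G` analytic and commuting with `a`, then
`a ^ p - c` is a multiple of `a ^ (p + 1)`. -/
theorem exists_pow_sub_eq_pow_succ_mul {a : A} {p : ℕ} {c : A} {G : ℂ → A}
    (hG : AnalyticAt ℂ G 0) (hcomm : ∀ᶠ w in 𝓝[≠] (0 : ℂ), Commute a (G w))
    (h : ∀ᶠ w in 𝓝[≠] (0 : ℂ), (algebraMap ℂ A w - a) * G w = algebraMap ℂ A (w ^ p) - c) :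
    ∃ b, Commute a b ∧ a ^ p - c = a ^ (p + 1) * b := by
  have hcont : Tendsto G (𝓝[≠] 0) (𝓝 (G 0)) := hG.continuousAt.tendsto.mono_left nhdsWithin_le_nhds
  have hid : Tendsto (fun w : ℂ => algebraMap ℂ A w) (𝓝[≠] 0) (𝓝 0) := by
    have : Continuous fun w : ℂ => algebraMap ℂ A w := continuous_algebraMap ℂ A
    simpa using (this.tendsto 0).mono_left nhdsWithin_le_nhds
  have h0 : Commute a (G 0) :=
    tendsto_nhds_unique_of_eventuallyEq (hcont.const_mul a) (hcont.mul_const a) hcomm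
  have hlim : -(a * G 0) = algebraMap ℂ A (0 ^ p) - c := by
    have h1 : Tendsto (fun w => (algebraMap ℂ A w - a) * G w) (𝓝[≠] 0) (𝓝 ((0 - a) * G 0)) :=
      (hid.sub_const a).mul hcont
    have h2 : Tendsto (fun w : ℂ => algebraMap ℂ A (w ^ p) - c) (𝓝[≠] 0)
        (𝓝 (algebraMap ℂ A (0 ^ p) - c)) := by
      have : Continuous fun w : ℂ => algebraMap ℂ A (w ^ p) - c := by fun_prop
      exact (this.tendsto 0).mono_left nhdsWithin_le_nhds
    simpa using tendsto_nhds_unique_of_eventuallyEq h1 h2 h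
  -- Letting `w → 0` gives `c = a G(0)` when the exponent is positive. Dividing by `w` then yields
  -- the same identity for `(G(w) - G(0)) / w`, with exponent one lower and `G(0)` in place of `c`;
  -- this is why `c` must be arbitrary.
  induction p generalizing c G with
  | zero => exact ⟨-G 0, h0.neg_right, by simpa using hlim.symm⟩
  | succ p ih =>
    have hc : c = a * G 0 := by simpa using hlim.symm
    have hG' : AnalyticAt ℂ (dslope G 0) 0 := by
      obtain ⟨q, hq⟩ := hG
      exact ⟨_, hq.has_fpower_series_dslope_fslope⟩
    have hd : ∀ w : ℂ, w ≠ 0 → dslope G 0 w = w⁻¹ • (G w - G 0) := fun w hw => by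
      rw [dslope_of_ne _ hw, slope_def_module, sub_zero]
    have hcomm' : ∀ᶠ w in 𝓝[≠] (0 : ℂ), Commute a (dslope G 0 w) := by
      filter_upwards [hcomm, self_mem_nhdsWithin] with w hw hw0
      rw [hd w hw0]
      exact (hw.sub_right h0).smul_right _
    have h' : ∀ᶠ w in 𝓝[≠] (0 : ℂ),
        (algebraMap ℂ A w - a) * dslope G 0 w = algebraMap ℂ A (w ^ p) - G 0 := by
      filter_upwards [h, self_mem_nhdsWithin] with w hw hw0
      have hw0' : w ≠ 0 := hw0
      rw [hd w hw0, mul_smul_comm, mul_sub, hw, hc, sub_mul, ← Algebra.smul_def, pow_succ', map_mul,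
        ← Algebra.smul_def]
      rw [inv_smul_eq_iff₀ hw0', smul_sub]
      abel
    have hcont' : Tendsto (dslope G 0) (𝓝[≠] 0) (𝓝 (dslope G 0 0)) :=
      hG'.continuousAt.tendsto.mono_left nhdsWithin_le_nhds
    obtain ⟨b, hb, hab⟩ := ih hG' hcomm' h' hcont'
      (tendsto_nhds_unique_of_eventuallyEq (hcont'.const_mul a) (hcont'.mul_const a) hcomm') (by
        have h1 : Tendsto (fun w => (algebraMap ℂ A w - a) * dslope G 0 w) (𝓝[≠] 0)
            (𝓝 ((0 - a) * dslope G 0 0)) := (hid.sub_const a).mul hcont'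
        have h2 : Tendsto (fun w : ℂ => algebraMap ℂ A (w ^ p) - G 0) (𝓝[≠] 0)
            (𝓝 (algebraMap ℂ A (0 ^ p) - G 0)) := by
          have : Continuous fun w : ℂ => algebraMap ℂ A (w ^ p) - G 0 := by fun_prop
          exact (this.tendsto 0).mono_left nhdsWithin_le_nhds
        simpa using tendsto_nhds_unique_of_eventuallyEq h1 h2 h')
    refine ⟨b, hb, ?_⟩
    rw [hc, pow_succ' a p, ← mul_sub, hab, pow_succ' a (p + 1), mul_assoc]

/-- At an isolated point of the spectrum where the resolvent is meromorphic, the powers of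
`s - m` stabilise. -/
theorem exists_pow_eq_pow_succ_mul_of_meromorphicAt {s : A} {m : ℂ}
    (hs : ∀ᶠ z in 𝓝[≠] m, z ∉ _root_.spectrum ℂ s) (hm : MeromorphicAt (resolvent s) m) :
    ∃ (p : ℕ) (b : A), Commute (s - algebraMap ℂ A m) b ∧
      (s - algebraMap ℂ A m) ^ p = (s - algebraMap ℂ A m) ^ (p + 1) * b := by
  obtain ⟨p, hp⟩ := hm
  have hmap : Tendsto (fun w : ℂ => m + w) (𝓝[≠] 0) (𝓝[≠] m) := by
    refine tendsto_nhdsWithin_of_tendsto_nhds_of_eventually_within _ ?_ ?_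
    · have : Continuous fun w : ℂ => m + w := by fun_prop
      simpa using (this.tendsto 0).mono_left nhdsWithin_le_nhds
    · filter_upwards [self_mem_nhdsWithin] with w hw
      simpa using hw
  -- Clearing the pole and moving `m` to `0` gives the preceding lemma with `c = 0`.
  have hG : AnalyticAt ℂ (fun w : ℂ => w ^ p • resolvent s (m + w)) 0 := by
    have : AnalyticAt ℂ (fun w : ℂ => m + w) 0 := by fun_prop
    have h2 := AnalyticAt.fun_comp (f := fun w : ℂ => m + w)
      (g := fun z : ℂ => (z - m) ^ p • resolvent s z) (x := (0 : ℂ)) (by simpa using hp) this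
    simpa using h2
  have key : ∀ᶠ w in 𝓝[≠] (0 : ℂ), IsUnit (algebraMap ℂ A w - (s - algebraMap ℂ A m)) ∧
      resolvent s (m + w) = Ring.inverse (algebraMap ℂ A w - (s - algebraMap ℂ A m)) := by
    filter_upwards [hmap.eventually hs] with w hw
    have e : algebraMap ℂ A (m + w) - s = algebraMap ℂ A w - (s - algebraMap ℂ A m) := by
      rw [map_add]; abel
    rw [spectrum.notMem_iff, e] at hw
    exact ⟨hw, by rw [resolvent, e]⟩
  have hcomm : ∀ᶠ w in 𝓝[≠] (0 : ℂ),
      Commute (s - algebraMap ℂ A m) (w ^ p • resolvent s (m + w)) := by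
    filter_upwards [key] with w hw
    rw [hw.2]
    exact (commute_ringInverse
      ((Algebra.commute_algebraMap_right _ _).sub_right (Commute.refl _))).smul_right _
  have heq : ∀ᶠ w in 𝓝[≠] (0 : ℂ), (algebraMap ℂ A w - (s - algebraMap ℂ A m)) *
      (w ^ p • resolvent s (m + w)) = algebraMap ℂ A (w ^ p) - 0 := by
    filter_upwards [key] with w hw
    rw [hw.2, mul_smul_comm, Ring.mul_inverse_cancel _ hw.1, sub_zero,
      Algebra.algebraMap_eq_smul_one]
  obtain ⟨b, hb, h⟩ := exists_pow_sub_eq_pow_succ_mul hG hcomm heq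
  exact ⟨p, b, hb, by simpa using h⟩

/-- The resolvent near `0` of an element `a` with Drazin inverse `b`. -/
theorem mul_drazin_resolvent_eq_one {a b : A} {n : ℕ} (hab : Commute a b)
    (h : a ^ (n + 1) * b = a ^ n) (hb : b * a * b = b) {w : ℂ} (hw : w ≠ 0)
    (hu : IsUnit (1 - w • b)) :
    (algebraMap ℂ A w - a) * (((w ^ n)⁻¹ •
      ∑ i ∈ Finset.range n, algebraMap ℂ A w ^ i * a ^ (n - 1 - i)) * (1 - a * b) -
        b * Ring.inverse (1 - w • b)) = 1 := by
  -- On the range of the idempotent `1 - a b`, `a` is nilpotent and a finite geometric sum inverts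
  -- `w - a`. On the range of `a b`, `b` inverts `a` and the inverse is `-b (1 - w b)⁻¹`.
  have h1 := (Algebra.commute_algebraMap_left w a).mul_geom_sum₂ n
  have h2 : a ^ n * (1 - a * b) = 0 := by rw [mul_sub, mul_one, ← mul_assoc, ← pow_succ, h, sub_self]
  have h3 : (algebraMap ℂ A w - a) * b = -(a * b) * (1 - w • b) := by
    have : a * (b * b) = b := by rw [← mul_assoc, hab.eq, hb]
    rw [mul_sub, mul_smul_comm, mul_one, neg_mul, mul_assoc a b b, this, sub_mul,
      ← Algebra.smul_def, smul_neg]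
    abel
  rw [mul_sub, ← mul_assoc _ b, h3, mul_assoc _ _ (Ring.inverse _), Ring.mul_inverse_cancel _ hu,
    ← mul_assoc, mul_smul_comm, h1, smul_mul_assoc, sub_mul, h2, ← map_pow, sub_zero,
    ← Algebra.smul_def, inv_smul_smul₀ (pow_ne_zero _ hw)]
  noncomm_ring

/-- If `s - m` has a Drazin inverse, then the resolvent of `s` is defined near `m`, except perhaps
at `m`, and meromorphic at `m`. -/
theorem meromorphicAt_resolvent_of_drazin [CompleteSpace A] {s b : A} {m : ℂ} {n : ℕ}
    (hab : Commute (s - algebraMap ℂ A m) b)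
    (h : (s - algebraMap ℂ A m) ^ (n + 1) * b = (s - algebraMap ℂ A m) ^ n)
    (hb : b * (s - algebraMap ℂ A m) * b = b) :
    (∀ᶠ z in 𝓝[≠] m, z ∉ _root_.spectrum ℂ s) ∧ MeromorphicAt (resolvent s) m := by
  set a := s - algebraMap ℂ A m with ha
  have hu : ∀ᶠ z in 𝓝[≠] m, IsUnit (1 - (z - m) • b) := by
    have hc : ContinuousAt (fun z : ℂ => 1 - (z - m) • b) m := by fun_prop
    have : {x : A | IsUnit x} ∈ 𝓝 (1 - (m - m) • b) := by
      simpa using Units.isOpen.mem_nhds (isUnit_one (M := A))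
    exact (hc.eventually this).filter_mono nhdsWithin_le_nhds
  let R : ℂ → A := fun z => (((z - m) ^ n)⁻¹ •
      ∑ i ∈ Finset.range n, algebraMap ℂ A (z - m) ^ i * a ^ (n - 1 - i)) * (1 - a * b) -
        b * Ring.inverse (1 - (z - m) • b)
  have key : ∀ᶠ z in 𝓝[≠] m, IsUnit (algebraMap ℂ A z - s) ∧
      Ring.inverse (algebraMap ℂ A z - s) = R z := by
    filter_upwards [hu, self_mem_nhdsWithin] with z hz hzm
    have e : algebraMap ℂ A z - s = algebraMap ℂ A (z - m) - a := by
      rw [ha, map_sub]; abel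
    have h1 := mul_drazin_resolvent_eq_one hab h hb (sub_ne_zero.2 hzm) hz
    have hcomm : Commute (algebraMap ℂ A (z - m) - a) (R z) := by
      have hsa : Commute a (algebraMap ℂ A (z - m)) := Algebra.commute_algebraMap_right _ _
      have ha' : Commute a (R z) := by
        refine Commute.sub_right (Commute.mul_right (Commute.smul_right ?_ _) ?_) ?_
        · exact Commute.sum_right _ _ _ fun i _ =>
            (hsa.pow_right i).mul_right ((Commute.refl a).pow_right _)
        · exact (Commute.one_right a).sub_right ((Commute.refl a).mul_right hab)
        · exact hab.mul_right (commute_ringInverse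
            (Commute.sub_right (Commute.one_right a) (Commute.smul_right hab _)))
      exact (Algebra.commute_algebraMap_left _ _).sub_left ha'
    rw [← e] at h1 hcomm
    let u : Aˣ := ⟨algebraMap ℂ A z - s, R z, h1, hcomm.eq.symm.trans h1⟩
    exact ⟨u.isUnit, Ring.inverse_unit u⟩
  refine ⟨key.mono fun z hz => spectrum.notMem_iff.2 hz.1, ?_⟩
  have hR : MeromorphicAt R m := by
    have hsum : AnalyticAt ℂ (fun z : ℂ => (∑ i ∈ Finset.range n,
        algebraMap ℂ A (z - m) ^ i * a ^ (n - 1 - i)) * (1 - a * b)) m := by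
      simp only [Algebra.algebraMap_eq_smul_one]
      fun_prop
    have hinv : AnalyticAt ℂ (fun z : ℂ => b * Ring.inverse (1 - (z - m) • b)) m := by
      have h1 : AnalyticAt ℂ (fun z : ℂ => 1 - (z - m) • b) m := by fun_prop
      have h2 : AnalyticAt ℂ (Ring.inverse : A → A) (1 - (m - m) • b) := by
        simpa using analyticAt_inverse (𝕜 := ℂ) (1 : Aˣ)
      exact analyticAt_const.mul (AnalyticAt.fun_comp (f := fun z : ℂ => 1 - (z - m) • b) h2 h1)
    have hpow : MeromorphicAt (fun z : ℂ => ((z - m) ^ n)⁻¹) m := by fun_prop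
    have := (hpow.smul hsum.meromorphicAt).sub hinv.meromorphicAt
    convert this using 1
    ext z
    simp [R]
  exact hR.congr (key.mono fun z hz => hz.2.symm)

/-- A point of the spectrum at which the resolvent is meromorphic, and which is isolated, is a
pole. -/
theorem isPole_resolvent {s : A} {m : ℂ} (hm : m ∈ _root_.spectrum ℂ s)
    (hs : ∀ᶠ z in 𝓝[≠] m, z ∉ _root_.spectrum ℂ s) (hmer : MeromorphicAt (resolvent s) m) :
    IsPole (resolvent s) m := by
  refine ⟨hmer, not_le.1 fun hle => hm ?_⟩
  -- Were the order nonnegative, the limit of the resolvent would invert `m - s`.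
  obtain ⟨g, hg⟩ := tendsto_nhds_of_meromorphicOrderAt_nonneg hmer hle
  have hc : Tendsto (fun z : ℂ => algebraMap ℂ A z - s) (𝓝[≠] m) (𝓝 (algebraMap ℂ A m - s)) := by
    have : Continuous fun z : ℂ => algebraMap ℂ A z - s := by fun_prop
    exact (this.tendsto m).mono_left nhdsWithin_le_nhds
  have h1 : (algebraMap ℂ A m - s) * g = 1 := by
    refine tendsto_nhds_unique_of_eventuallyEq (hc.mul hg) tendsto_const_nhds ?_
    filter_upwards [hs] with z hz
    exact Ring.mul_inverse_cancel _ (spectrum.notMem_iff.1 hz)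
  have h2 : g * (algebraMap ℂ A m - s) = 1 := by
    refine tendsto_nhds_unique_of_eventuallyEq (hg.mul hc) tendsto_const_nhds ?_
    filter_upwards [hs] with z hz
    exact Ring.inverse_mul_cancel _ (spectrum.notMem_iff.1 hz)
  exact (⟨_, g, h1, h2⟩ : Aˣ).isUnit

end Algebra

end ClosedOperator
-- Construction of the Drazin inverse.
namespace ClosedOperator

section Bounded

variable {X : Type*} [NormedAddCommGroup X] [NormedSpace ℂ X]

theorem isClosed_ker_pow (a : X →L[ℂ] X) (d : ℕ) :
    IsClosed (LinearMap.ker ((a : Module.End ℂ X) ^ d) : Set X) := by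
  rw [← ContinuousLinearMap.toLinearMap_pow]
  exact (a ^ d).isClosed_ker

variable [CompleteSpace X]

/-- If `X = R(a) + N(a ^ d)` and `N(a) ∩ R(a ^ d) = 0`, then `a` has a Drazin inverse. -/
theorem exists_drazin (a : X →L[ℂ] X) (d : ℕ)
    (hk : LinearMap.ker (a : Module.End ℂ X) ⊓ LinearMap.range ((a : Module.End ℂ X) ^ d) = ⊥)
    (hr : LinearMap.range (a : Module.End ℂ X) ⊔ LinearMap.ker ((a : Module.End ℂ X) ^ d) = ⊤) :
    ∃ b : X →L[ℂ] X, Commute a b ∧ a ^ (d + 1) * b = a ^ d ∧ b * a * b = b := by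
  set N := LinearMap.ker ((a : Module.End ℂ X) ^ d) with hN
  have : IsClosed (N : Set X) := isClosed_ker_pow a d
  have hmem : ∀ x, x ∈ N ↔ (a ^ d) x = 0 := fun x => by
    rw [hN, ← ContinuousLinearMap.toLinearMap_pow]; exact LinearMap.mem_ker
  have hpa : ∀ n x, (a ^ n) (a x) = a ((a ^ n) x) := fun n x =>
    DFunLike.congr_fun ((Commute.refl a).pow_left n).eq x
  -- Since `N` is closed, `X ⧸ N` is a Banach space, whereas `R(a ^ d)` is not known to be closed.
  -- The map `B` induced by `a` is injective by `hk` and surjective by `hr`, so its inverse is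
  -- bounded; `J`, induced by `a ^ d`, leads back to `X`.
  let π : X →L[ℂ] X ⧸ N := N.mkQL
  let J : X ⧸ N →L[ℂ] X := N.liftQL (a ^ d) fun x hx => (hmem x).1 hx
  let B : X ⧸ N →L[ℂ] X ⧸ N := N.liftQL (π ∘L a) fun x hx => by
    refine (Submodule.Quotient.mk_eq_zero N).2 ((hmem _).2 ?_)
    change (a ^ d) (a x) = 0
    rw [hpa, (hmem x).1 hx, map_zero]
  have hπ : Function.Surjective π := N.mkQ_surjective
  have hJ : ∀ x, J (π x) = (a ^ d) x := fun x => rfl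
  have hB : ∀ x, B (π x) = π (a x) := fun x => rfl
  have hπ0 : ∀ x, π x = 0 ↔ (a ^ d) x = 0 := fun x =>
    (Submodule.Quotient.mk_eq_zero N).trans (hmem x)
  have hinj : LinearMap.ker (B : X ⧸ N →ₗ[ℂ] X ⧸ N) = ⊥ := by
    refine LinearMap.ker_eq_bot'.2 fun y hy => ?_
    obtain ⟨x, rfl⟩ := hπ y
    have hx : (a ^ d) (a x) = 0 := (hπ0 _).1 hy
    rw [hpa] at hx
    have : (a ^ d) x ∈ LinearMap.ker (a : Module.End ℂ X) ⊓
        LinearMap.range ((a : Module.End ℂ X) ^ d) :=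
      ⟨hx, by rw [← ContinuousLinearMap.toLinearMap_pow]; exact ⟨x, rfl⟩⟩
    rw [hk] at this
    exact (hπ0 x).2 this
  have hsurj : LinearMap.range (B : X ⧸ N →ₗ[ℂ] X ⧸ N) = ⊤ := by
    refine LinearMap.range_eq_top.2 fun y => ?_
    obtain ⟨x, rfl⟩ := hπ y
    obtain ⟨_, ⟨u, rfl⟩, n, hn, rfl⟩ := Submodule.mem_sup.1 (hr ▸ Submodule.mem_top (x := x))
    refine ⟨π u, ?_⟩
    have : π n = 0 := (hπ0 n).2 ((hmem n).1 hn)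
    rw [map_add, this, add_zero]
    rfl
  let e := ContinuousLinearEquiv.ofBijective B hinj hsurj
  let V : (X ⧸ N) →L[ℂ] (X ⧸ N) := e.symm
  have hBV : B * V = 1 := by
    ext1 y; exact ContinuousLinearEquiv.ofBijective_apply_symm_apply B hinj hsurj y
  have hVB : V * B = 1 := by
    ext1 y; exact ContinuousLinearEquiv.ofBijective_symm_apply_apply B hinj hsurj y
  have hc : Commute B V := hBV.trans hVB.symm
  have hBVn : ∀ n y, (B ^ n) ((V ^ n) y) = y := fun n y => by
    have : B ^ n * V ^ n = 1 := by rw [← hc.mul_pow, hBV, one_pow]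
    exact DFunLike.congr_fun this y
  have hVnB : ∀ n y, (V ^ (n + 1)) (B y) = (V ^ n) y := fun n y => by
    have : V ^ (n + 1) * B = V ^ n := by rw [pow_succ, mul_assoc, hVB, mul_one]
    exact DFunLike.congr_fun this y
  have hBVn' : ∀ n y, B ((V ^ (n + 1)) y) = (V ^ n) y := fun n y => by
    have : B * V ^ (n + 1) = V ^ n := by rw [pow_succ', ← mul_assoc, hBV, one_mul]
    exact DFunLike.congr_fun this y
  have hJB : ∀ y, J (B y) = a (J y) := fun y => by
    obtain ⟨x, rfl⟩ := hπ y
    rw [hB, hJ, hJ, hpa]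
  have hJBn : ∀ n y, J ((B ^ n) y) = (a ^ n) (J y) := fun n => by
    induction n with
    | zero => intro y; rfl
    | succ n ih =>
      intro y
      rw [pow_succ', pow_succ']
      exact (hJB _).trans (congrArg a (ih y))
  have hBπ : ∀ n x, (B ^ n) (π x) = π ((a ^ n) x) := fun n => by
    induction n with
    | zero => intro x; rfl
    | succ n ih =>
      intro x
      rw [pow_succ', pow_succ']
      exact (congrArg B (ih x)).trans (hB _)
  have hπJ : ∀ y, π (J y) = (B ^ d) y := fun y => by
    obtain ⟨x, rfl⟩ := hπ y
    rw [hJ, hBπ]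
  have hab : ∀ x, a (J ((V ^ (d + 1)) (π x))) = J ((V ^ d) (π x)) := fun x => by
    rw [← hJB, hBVn']
  -- Formally `a ^ d a ^ (-(d + 1))`: the negative power is taken in the quotient.
  refine ⟨J ∘L (V ^ (d + 1)) ∘L π, ?_, ?_, ?_⟩
  · ext x
    change a (J ((V ^ (d + 1)) (π x))) = J ((V ^ (d + 1)) (π (a x)))
    rw [hab, ← hB, hVnB]
  · ext x
    rw [pow_succ]
    change (a ^ d) (a (J ((V ^ (d + 1)) (π x)))) = _
    rw [hab, ← hJBn, hBVn, hJ]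
  · ext x
    change J ((V ^ (d + 1)) (π (a (J ((V ^ (d + 1)) (π x)))))) = J ((V ^ (d + 1)) (π x))
    rw [hab, hπJ, hBVn]

end Bounded

end ClosedOperator
-- Eigenvectors filling a neighbourhood.
namespace ClosedOperator

open Filter Topology

section Bounded

variable {X : Type*} [NormedAddCommGroup X] [NormedSpace ℂ X] [CompleteSpace X]

/-- A sum `R(a) + N` of finite codimension, with `N` closed, admits bounded decompositions. -/
theorem exists_bounded_decomposition (a : X →L[ℂ] X) (N : Submodule ℂ X)
    (hN : IsClosed (N : Set X))
    (hfin : FiniteDimensional ℂ (X ⧸ (LinearMap.range (a : Module.End ℂ X) ⊔ N))) :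
    ∃ C > 0, ∀ x ∈ LinearMap.range (a : Module.End ℂ X) ⊔ N,
      ∃ y, a y - x ∈ N ∧ ‖y‖ ≤ C * ‖x‖ := by
  set M := LinearMap.range (a : Module.End ℂ X) ⊔ N with hM
  obtain ⟨F, hF⟩ := M.exists_isCompl
  have : FiniteDimensional ℂ F :=
    (Submodule.quotientEquivOfIsCompl M F hF).finiteDimensional
  have : CompleteSpace N := hN.completeSpace_coe
  have : CompleteSpace F := FiniteDimensional.complete ℂ F
  -- The open mapping theorem for this surjection gives `C`. For `x` in `R(a) + N` the component in
  -- the complement `F` vanishes.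
  let Φ : (X × N) × F →L[ℂ] X := (a.coprod N.subtypeL).coprod F.subtypeL
  have hΦ : ∀ y n f, Φ ((y, n), f) = a y + n + f := fun y n f => rfl
  have hsurj : Function.Surjective Φ := by
    intro x
    obtain ⟨m, hm, f, hf, rfl⟩ := Submodule.mem_sup.1
      (hF.sup_eq_top ▸ Submodule.mem_top (x := x) : x ∈ M ⊔ F)
    obtain ⟨_, ⟨y, rfl⟩, n, hn, rfl⟩ := Submodule.mem_sup.1 hm
    exact ⟨((y, ⟨n, hn⟩), ⟨f, hf⟩), rfl⟩
  obtain ⟨C, hC, h⟩ := Φ.exists_preimage_norm_le hsurj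
  refine ⟨C, hC, fun x hx => ?_⟩
  obtain ⟨⟨⟨y, n⟩, f⟩, hyx, hle⟩ := h x
  rw [hΦ] at hyx
  have hm : a y + n ∈ M := add_mem (Submodule.mem_sup_left ⟨y, rfl⟩) (Submodule.mem_sup_right n.2)
  have hf : (f : X) ∈ M ⊓ F := by
    refine ⟨?_, f.2⟩
    have := sub_mem hx hm
    rwa [← hyx, add_sub_cancel_left] at this
  rw [hF.inf_eq_bot, Submodule.mem_bot] at hf
  rw [hf, add_zero] at hyx
  refine ⟨y, ?_, le_trans ?_ hle⟩
  · rw [← hyx, sub_add_cancel_left]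
    exact neg_mem n.2
  · exact (le_max_left _ _).trans (le_max_left _ _)

/-- If `R(a) + N(a ^ d)` has finite codimension, `d` is a degree of stable iteration and
`N(a) ∩ R(a ^ d)` is nonzero, then all small numbers are eigenvalues of `a`. -/
theorem eventually_exists_eigenvector (a : X →L[ℂ] X) (d : ℕ)
    (hd : ∀ m, d ≤ m → LinearMap.range ((a : Module.End ℂ X) ^ m) ⊓
      LinearMap.ker (a : Module.End ℂ X) =
        LinearMap.range ((a : Module.End ℂ X) ^ d) ⊓ LinearMap.ker (a : Module.End ℂ X))
    (hfin : FiniteDimensional ℂ (X ⧸ (LinearMap.range (a : Module.End ℂ X) ⊔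
      LinearMap.ker ((a : Module.End ℂ X) ^ d))))
    (hne : LinearMap.ker (a : Module.End ℂ X) ⊓ LinearMap.range ((a : Module.End ℂ X) ^ d) ≠ ⊥) :
    ∀ᶠ w in 𝓝 (0 : ℂ), ∃ u, u ≠ 0 ∧ a u = w • u := by
  set f : Module.End ℂ X := (a : Module.End ℂ X) with hf
  have hfa : ∀ n x, (f ^ n) x = (a ^ n) x := fun n x => by
    rw [hf, ← ContinuousLinearMap.toLinearMap_pow]; rfl
  have hpa : ∀ n x, (a ^ n) (a x) = a ((a ^ n) x) := fun n x =>
    DFunLike.congr_fun ((Commute.refl a).pow_left n).eq x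
  have hmem : ∀ x, x ∈ LinearMap.ker (f ^ d) ↔ (a ^ d) x = 0 := fun x => by
    rw [LinearMap.mem_ker, hfa]
  obtain ⟨C, hC, hdec⟩ := exists_bounded_decomposition a _ (isClosed_ker_pow a d) hfin
  have hstable : ∀ x, x ∈ LinearMap.range (f ^ d) → f x = 0 →
      ∀ m, x ∈ LinearMap.range (f ^ m) := by
    intro x hx hx0 m
    rcases le_total d m with hm | hm
    · exact ((hd m hm).ge ⟨hx, hx0⟩).1
    · obtain ⟨k, rfl⟩ := Nat.exists_eq_add_of_le hm
      rw [pow_add] at hx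
      exact LinearMap.range_comp_le_range _ _ hx
  -- Backward orbits are built as `a ^ d` of a sequence `x_n`, because norm control is available for
  -- the `x_n` and not directly inside `R(a ^ d)`.
  have hstep : ∀ x : {x : X // ∀ m, (f ^ d) x ∈ LinearMap.range (f ^ m)},
      ∃ y : {x : X // ∀ m, (f ^ d) x ∈ LinearMap.range (f ^ m)},
        (a ^ d) (a y) = (a ^ d) x ∧ ‖(y : X)‖ ≤ C * ‖(x : X)‖ := by
    rintro ⟨x, hx⟩
    obtain ⟨v, hv⟩ := hx (d + 1)
    have hxM : x ∈ LinearMap.range f ⊔ LinearMap.ker (f ^ d) := by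
      rw [← add_sub_cancel (f v) x]
      refine add_mem (Submodule.mem_sup_left ⟨v, rfl⟩) (Submodule.mem_sup_right ?_)
      rw [LinearMap.mem_ker, map_sub, ← hv, pow_succ]
      exact sub_self _
    obtain ⟨y, hy, hle⟩ := hdec x hxM
    have hyx : (a ^ d) (a y) = (a ^ d) x := by
      rw [← sub_eq_zero, ← map_sub]; exact (hmem _).1 hy
    refine ⟨⟨y, fun m => ?_⟩, hyx, hle⟩
    -- Both `a ^ d y` and `a ^ (d + m) v` are mapped by `a` to `a ^ d x`. Their difference lies in
    -- `N(a) ∩ R(a ^ d)`, hence in `R(a ^ m)` by stability.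
    obtain ⟨v, hv⟩ := hx ((d + m) + 1)
    have hmm : (f ^ (d + m)) v ∈ LinearMap.range (f ^ m) := by
      rw [add_comm, pow_add]; exact ⟨_, rfl⟩
    have h0 : f ((f ^ d) y - (f ^ (d + m)) v) = 0 := by
      rw [map_sub, ← Module.End.mul_apply f (f ^ (d + m)), ← pow_succ', hv, hfa, hfa, ← hyx, hpa]
      exact sub_self _
    have hr : (f ^ d) y - (f ^ (d + m)) v ∈ LinearMap.range (f ^ d) :=
      sub_mem ⟨y, rfl⟩ (by rw [pow_add]; exact ⟨_, rfl⟩)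
    have := add_mem (hstable _ hr h0 m) hmm
    rwa [sub_add_cancel] at this
  choose g hg hgC using hstep
  obtain ⟨y0, ⟨hy0, x0, hx0⟩, hne0⟩ := (Submodule.ne_bot_iff _).1 hne
  let s : ℕ → {x : X // ∀ m, (f ^ d) x ∈ LinearMap.range (f ^ m)} := fun n =>
    g^[n] ⟨x0, fun m => hx0 ▸ hstable y0 ⟨x0, hx0⟩ hy0 m⟩
  have hs : ∀ n, s (n + 1) = g (s n) := fun n => Function.iterate_succ_apply' _ _ _
  let y : ℕ → X := fun n => (a ^ d) (s n)
  have hy00 : y 0 = y0 := by rw [← hx0, hfa]; rfl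
  have hay0 : a (y 0) = 0 := by rw [hy00]; exact hy0
  have hay : ∀ n, a (y (n + 1)) = y n := fun n => by
    change a ((a ^ d) (s (n + 1))) = _
    rw [← hpa, hs, hg]
  have hsn : ∀ n, ‖(s n : X)‖ ≤ C ^ n * ‖x0‖ := fun n => by
    induction n with
    | zero => simp [s]
    | succ n ih =>
      rw [hs, pow_succ', mul_assoc]
      exact (hgC _).trans (mul_le_mul_of_nonneg_left ih hC.le)
  have hyn : ∀ n, ‖y n‖ ≤ ‖a ^ d‖ * ‖x0‖ * C ^ n := fun n => by
    refine ((a ^ d).le_opNorm _).trans ?_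
    rw [mul_assoc, mul_comm ‖x0‖]
    exact mul_le_mul_of_nonneg_left (hsn n) (norm_nonneg _)
  set K := ‖a ^ d‖ * ‖x0‖ with hK
  -- From `a y_0 = 0` and `a y_(n+1) = y_n`, the sum of `w ^ n y_n` is an eigenvector for `w`. The
  -- bounds ensure convergence and that the tail cannot cancel `y_0`.
  have hbound : ∀ᶠ w in 𝓝 (0 : ℂ), C * ‖w‖ < 1 ∧ K * (C * ‖w‖) * (1 - C * ‖w‖)⁻¹ < ‖y0‖ := by
    have h1 : ContinuousAt (fun w : ℂ => C * ‖w‖) 0 := by fun_prop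
    have h2 : ContinuousAt (fun w : ℂ => K * (C * ‖w‖) * (1 - C * ‖w‖)⁻¹) 0 := by
      refine ContinuousAt.mul (by fun_prop) (ContinuousAt.inv₀ (by fun_prop) (by simp))
    exact (h1.eventually_lt continuousAt_const (by simp)).and
      (h2.eventually_lt continuousAt_const (by simpa using hne0))
  filter_upwards [hbound] with w ⟨hw1, hw2⟩
  have hr0 : 0 ≤ C * ‖w‖ := by positivity
  have hterm : ∀ n, ‖w ^ n • y n‖ ≤ K * (C * ‖w‖) ^ n := fun n => by
    rw [norm_smul, norm_pow, mul_pow, mul_comm, ← mul_assoc]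
    exact mul_le_mul_of_nonneg_right (hyn n) (by positivity)
  have hgeo : Summable fun n => K * (C * ‖w‖) ^ n :=
    (summable_geometric_of_lt_one hr0 hw1).mul_left K
  have hsum : Summable fun n => w ^ n • y n := Summable.of_norm_bounded hgeo hterm
  have hsplit := hsum.tsum_eq_zero_add
  refine ⟨∑' n, w ^ n • y n, fun h0 => ?_, ?_⟩
  · rw [h0, pow_zero, one_smul, hy00] at hsplit
    have htail : ‖∑' n, w ^ (n + 1) • y (n + 1)‖ ≤ K * (C * ‖w‖) * (1 - C * ‖w‖)⁻¹ := by
      refine tsum_of_norm_bounded ?_ fun n => hterm (n + 1)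
      simp_rw [pow_succ', ← mul_assoc]
      exact (hasSum_geometric_of_lt_one hr0 hw1).mul_left _
    rw [← neg_eq_of_add_eq_zero_right hsplit.symm, norm_neg] at htail
    linarith
  · rw [a.map_tsum hsum, (a.summable hsum).tsum_eq_zero_add]
    simp only [map_smul, hay, hay0, smul_zero, zero_add, pow_succ', mul_smul]
    exact hsum.tsum_const_smul w

end Bounded

end ClosedOperator
-- Meromorphic operators and connectedness of the punctured plane.
namespace ClosedOperator

open Filter Topology

section Bounded

variable {X : Type*} [NormedAddCommGroup X] [NormedSpace ℂ X]

theorem isBWeylEnd_of_continuous_pow_eq {a b : X →L[ℂ] X} (hab : Commute a b) {p : ℕ}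
    (h : a ^ p = a ^ (p + 1) * b) : IsBWeylEnd (a : Module.End ℂ X) := by
  refine isBWeylEnd_of_pow_eq (b := (b : Module.End ℂ X)) (p := p) ?_ ?_
  · exact congrArg (fun c : X →L[ℂ] X => (c : Module.End ℂ X)) hab.eq
  · rw [← ContinuousLinearMap.toLinearMap_pow, ← ContinuousLinearMap.toLinearMap_pow]
    exact congrArg (fun c : X →L[ℂ] X => (c : Module.End ℂ X)) h

theorem coe_sub_algebraMap (S : X →L[ℂ] X) (m : ℂ) :
    ((S - algebraMap ℂ (X →L[ℂ] X) m : X →L[ℂ] X) : Module.End ℂ X) =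
      (S : Module.End ℂ X) - m • 1 := by
  rw [Algebra.algebraMap_eq_smul_one]; rfl

theorem isBWeylEnd_of_isMeromorphicOperator {S : X →L[ℂ] X} (hS : IsMeromorphicOperator S) {m : ℂ}
    (hm : m ≠ 0) : IsBWeylEnd ((S : Module.End ℂ X) - m • 1) := by
  rw [← coe_sub_algebraMap]
  by_cases hmem : m ∈ _root_.spectrum ℂ S
  · have hacc : ¬ AccPt m (𝓟 (_root_.spectrum ℂ S)) := fun h => hm (hS.1 m h)
    have hiso : ∀ᶠ z in 𝓝[≠] m, z ∉ _root_.spectrum ℂ S := by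
      rw [accPt_iff_frequently, not_frequently] at hacc
      exact eventually_nhdsWithin_iff.2 (hacc.mono fun z hz hne hzs => hz ⟨hne, hzs⟩)
    obtain ⟨p, b, hb, h⟩ :=
      exists_pow_eq_pow_succ_mul_of_meromorphicAt hiso (hS.2 m hmem hm hacc).1
    exact isBWeylEnd_of_continuous_pow_eq hb h
  · rw [spectrum.notMem_iff, ← IsUnit.neg_iff, neg_sub] at hmem
    refine isBWeylEnd_of_continuous_pow_eq (b := Ring.inverse _) (p := 0)
      (commute_ringInverse (Commute.refl _)) ?_
    rw [zero_add, pow_one, pow_zero, Ring.mul_inverse_cancel _ hmem]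

variable [CompleteSpace X]

/-- Near a point where `S - m` is B-Weyl, either the resolvent is meromorphic or the spectrum is a
neighbourhood. -/
theorem resolvent_meromorphicAt_or_eventually_mem_spectrum {S : X →L[ℂ] X} {m : ℂ}
    (h : IsBWeylEnd ((S : Module.End ℂ X) - m • 1)) :
    ((∀ᶠ z in 𝓝[≠] m, z ∉ _root_.spectrum ℂ S) ∧ MeromorphicAt (resolvent S) m) ∨
      ∀ᶠ z in 𝓝 m, z ∈ _root_.spectrum ℂ S := by
  rw [← coe_sub_algebraMap] at h
  obtain ⟨d, hd, -, hfin, hrank⟩ := h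
  set a := S - algebraMap ℂ (X →L[ℂ] X) m with ha
  by_cases hbot : LinearMap.ker (a : Module.End ℂ X) ⊓
      LinearMap.range ((a : Module.End ℂ X) ^ d) = ⊥
  · left
    -- Only here does index zero enter: a trivial null part makes the codimension zero.
    rw [hbot, finrank_bot] at hrank
    have := Module.finrank_zero_iff.1 hrank.symm
    obtain ⟨b, hab, h1, h2⟩ := exists_drazin a d hbot (Submodule.Quotient.subsingleton_iff.1 this)
    exact meromorphicAt_resolvent_of_drazin hab h1 h2
  · right
    have hev := eventually_exists_eigenvector a d hd hfin hbot
    have ht : Tendsto (fun z : ℂ => z - m) (𝓝 m) (𝓝 0) := by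
      have : Continuous fun z : ℂ => z - m := by fun_prop
      simpa using this.tendsto m
    filter_upwards [ht.eventually hev] with z ⟨u, hu0, hu⟩
    intro hunit
    have hu' : (algebraMap ℂ (X →L[ℂ] X) z - S) u = 0 := by
      have h1 : S u - m • u = (z - m) • u := by
        rw [← hu, ha, Algebra.algebraMap_eq_smul_one]; rfl
      have h2 : (algebraMap ℂ (X →L[ℂ] X) z - S) u = z • u - S u := by
        rw [Algebra.algebraMap_eq_smul_one]; rfl
      rw [h2, sub_eq_zero, ← sub_left_inj (a := m • u), h1, sub_smul]
    obtain ⟨v, hv⟩ := hunit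
    have : u = 0 := by
      have h3 : ((↑v⁻¹ : X →L[ℂ] X) * (v : X →L[ℂ] X)) u = 0 := by
        rw [mul_apply_eq_comp, hv]
        exact (congrArg _ hu').trans (map_zero _)
      simpa using h3
    exact hu0 this

/-- The open sets `U` and `V` are disjoint and cover the connected set `ℂ \ {0}`, which meets `U`
because the spectrum is bounded. So `V` contains no nonzero point. -/
theorem isMeromorphicOperator_of_forall_isBWeylEnd {S : X →L[ℂ] X}
    (h : ∀ m : ℂ, m ≠ 0 → IsBWeylEnd ((S : Module.End ℂ X) - m • 1)) :
    IsMeromorphicOperator S := by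
  let U : Set ℂ := {m | ∀ᶠ z in 𝓝[≠] m, z ∉ _root_.spectrum ℂ S}
  let V : Set ℂ := {m | ∀ᶠ z in 𝓝 m, z ∈ _root_.spectrum ℂ S}
  have hV : IsOpen V := isOpen_iff_mem_nhds.2 fun m hm => eventually_eventually_nhds.2 hm
  have hU : IsOpen U := by
    refine isOpen_iff_mem_nhds.2 fun m hm => ?_
    obtain ⟨O, hO, hmO, hsub⟩ := mem_nhdsWithin.1 hm
    filter_upwards [hO.mem_nhds hmO] with y hy
    by_cases hym : y = m
    · rw [hym]; exact hm
    · exact nhdsWithin_le_nhds (mem_of_superset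
        ((hO.inter isOpen_compl_singleton).mem_nhds ⟨hy, hym⟩) hsub)
  have hdich := fun m hm => resolvent_meromorphicAt_or_eventually_mem_spectrum (h m hm)
  have hempty : ∀ m, m ∈ U → m ∉ V := fun m hmU hmV => by
    have h1 : ∀ᶠ z in 𝓝[≠] m, z ∉ _root_.spectrum ℂ S := hmU
    have h2 : ∀ᶠ z in 𝓝 m, z ∈ _root_.spectrum ℂ S := hmV
    obtain ⟨z, hz1, hz2⟩ := (h1.and (h2.filter_mono nhdsWithin_le_nhds)).exists
    exact hz1 hz2
  have hpre : IsPreconnected ({0}ᶜ : Set ℂ) :=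
    (isConnected_compl_singleton_of_one_lt_rank (by simp) 0).isPreconnected
  have hne : (({0}ᶜ : Set ℂ) ∩ U).Nonempty := by
    -- The factor `‖1‖` covers the zero space, where it is `0`; adding `1` keeps the point nonzero
    -- and outside the spectral bound.
    have hpos : (0 : ℝ) < ‖S‖ * ‖(1 : X →L[ℂ] X)‖ + 1 := by positivity
    have hres : ((‖S‖ * ‖(1 : X →L[ℂ] X)‖ + 1 : ℝ) : ℂ) ∈ _root_.resolventSet ℂ S := by
      apply spectrum.mem_resolventSet_of_norm_lt_mul
      rw [Complex.norm_real, Real.norm_of_nonneg hpos.le]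
      exact lt_add_one _
    refine ⟨_, Complex.ofReal_ne_zero.2 hpos.ne', ?_⟩
    exact nhdsWithin_le_nhds (mem_of_superset
      ((spectrum.isOpen_resolventSet S).mem_nhds hres) fun z hz hzs => hzs hz)
  have hall : ∀ m : ℂ, m ≠ 0 → (∀ᶠ z in 𝓝[≠] m, z ∉ _root_.spectrum ℂ S) ∧
      MeromorphicAt (resolvent S) m := by
    intro m hm
    refine (hdich m hm).resolve_right fun hmV => ?_
    obtain ⟨y, -, hyU, hyV⟩ := hpre U V hU hV
      (fun z hz => (hdich z hz).imp (fun hz' => hz'.1) id) hne ⟨m, hm, hmV⟩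
    exact hempty y hyU hyV
  refine ⟨fun z hz => ?_, fun z hz hz0 _ => isPole_resolvent hz (hall z hz0).1 (hall z hz0).2⟩
  by_contra hz0
  rw [accPt_iff_frequently] at hz
  refine hz ((eventually_nhdsWithin_iff.1 (hall z hz0).1).mono fun y hy hy' => hy hy'.1 hy'.2)

end Bounded

end ClosedOperator
theorem theorem10 {X : Type*} [NormedAddCommGroup X] [NormedSpace ℂ X] [CompleteSpace X]
    (T : X →ₗ.[ℂ] X) (hT : T.IsClosed) (hρ : (ClosedOperator.resolventSet T).Nonempty) :
    ClosedOperator.HasPurelyBDiscreteSpectrum T ↔ ClosedOperator.HasMeromorphicResolvent T := by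
  rw [ClosedOperator.hasPurelyBDiscreteSpectrum_iff]
  constructor
  · intro h
    obtain ⟨z, S, hS⟩ := hρ
    exact ⟨z, S, hS,
      ClosedOperator.isMeromorphicOperator_of_forall_isBWeylEnd (hS.forall_isBWeyl_iff.1 h)⟩
  · rintro ⟨z, S, hS, hmer⟩
    exact hS.forall_isBWeyl_iff.2 fun m hm =>
      ClosedOperator.isBWeylEnd_of_isMeromorphicOperator hmer hm
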